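/- Let $q$ be an indeterminate. For $n\in\mathbb{N}$ put $[n]=1+q+\cdots+q^{n-1}$, and for integers $n,k$ let ${n\brack k}=\prod_{i=1}^{k}\frac{1-q^{n-i+1}}{1-q^{i}}$ if $k\ge 0$ and ${n\brack k}=0$ if $k<0$. Let $a,b,c,n$ be positive integers and let $j,r$ be non-negative integers with $j\le a+b+c$. For $k\ge 0$ let either $\varepsilon_k=q^{j(k^2+k)-(2r+1)k}$ (for all $k$) or $\varepsilon_k=(-1)^kq^{\binom{k}{2}+j(k^2+k)-2rk}$ (for all $k$). Then, for both choices, $$\sum_{k=0}^n\varepsilon_k[2k+1]^{2r+1}{2n+1\brack n-k}^a{2n+3\brack n-k+1}^b{2n+5\brack n-k+2}^c\equiv 0 \mod [2n+5]{2n+1\brack n},$$ that is, the sum on the left equals $[2n+5]{2n+1\brack n}$ times a Laurent polynomial in $q$ with integer coefficients. -/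

import Mathlib

open scoped LaurentPolynomial

noncomputable section

namespace QSum

/-- The indeterminate `q`, in the field `ℚ(q)` of rational functions. -/
def q : RatFunc ℚ := RatFunc.X

/-- `q` as a unit of `ℚ(q)`. -/
def qUnit : (RatFunc ℚ)ˣ := Units.mk0 q RatFunc.X_ne_zero

/-- The `q`-integer `[n] = 1 + q + ⋯ + q^(n-1)`. -/
def qInt (n : ℕ) : RatFunc ℚ := ∑ i ∈ Finset.range n, q ^ i

/-- The `q`-binomial coefficient: `∏_{i=1}^k (1 - q^(n-i+1)) / (1 - q^i)` for `k ≥ 0`, and `0`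
for `k < 0`. -/
def qBinom (n k : ℤ) : RatFunc ℚ :=
  if 0 ≤ k then
    ∏ i ∈ Finset.Icc 1 k.toNat, (1 - q ^ (n - (i : ℤ) + 1)) / (1 - q ^ (i : ℤ))
  else 0

/-- The embedding of the Laurent polynomials with integer coefficients into `ℚ(q)`, sending the
variable to `q`. -/
def ofLaurent : ℤ[T;T⁻¹] →+* RatFunc ℚ :=
  LaurentPolynomial.eval₂ (Int.castRingHom (RatFunc ℚ)) qUnit

/-- `A ≡ B mod D`: the difference `A - B` is `D` times a Laurent polynomial in `q` with integer
coefficients. -/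
def CongrMod (A B D : RatFunc ℚ) : Prop :=
  ∃ L : ℤ[T;T⁻¹], A - B = D * ofLaurent L

/-- `ε_k = q^(j(k²+k) - (2r+1)k)`. -/
def epsPos (j r k : ℕ) : RatFunc ℚ :=
  q ^ ((j : ℤ) * ((k : ℤ) ^ 2 + k) - (2 * (r : ℤ) + 1) * k)

/-- `ε_k = (-1)^k q^(k(k-1)/2 + j(k²+k) - 2rk)`. -/
def epsAlt (j r k : ℕ) : RatFunc ℚ :=
  (-1) ^ k * q ^ ((k.choose 2 : ℤ) + (j : ℤ) * ((k : ℤ) ^ 2 + k) - 2 * (r : ℤ) * k)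

end QSum

end

/-! Write `K_n(k)` for the kernel `1/([n-k]! [n+k+1]!)`, so that the binomial `[2n+1; n-k]` is
`[2n+1]! K_n(k)` and the sum becomes a weighted sum of products of kernels.

By `q`-Vandermonde, `[n+x+1]! K_n K_x` is a combination of the `K_s` with `s ≤ n`, and a second form
of the identity absorbs one factor `q^(k²+k)` (`linearize_sum`). Merging a sequence of kernels pair
by pair therefore uses one factorial `[m+m'+1]!` per adjacent pair, and the leftover denominators
combine into Gaussian binomials. Since `j` is at most the number of kernels, a single kernel with
exponent 0 or 1 remains (`path_sum_mem`).

The single-kernel sums are integral after multiplication by `[n]!²`: for `[2k+1]` times the sign and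
power of `q` in question they telescope or obey a short recursion (`integralWeight_pos`,
`integralWeight_alt`), and a further factor `q^(-2k)[2k+1]²` preserves integrality
(`IntegralWeight.mul_sq`).

The divisor comes from the order of the kernels: all `n`, then all `n+2`, then all `n+1`. The
adjacent factorials and the end factors `[n]! [n+1]!` then fall short of the product of binomials by
exactly `[2n+5] [2n+1; n]` (`gauss_sum_mem`). -/

namespace QSum

section Generic

variable {K : Type*} [Field K]

/-! ### Factorials, Gaussian binomials and `q`-Vandermonde -/

/-- The `q`-integer `(1 - q^z) / (1 - q)` at an integer `z`. -/
def qNum (q : K) (z : ℤ) : K := (1 - q ^ z) / (1 - q)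

/-- The `q`-factorial. -/
def qFact (q : K) (n : ℕ) : K := ∏ i ∈ Finset.range n, qNum q ((i : ℤ) + 1)

/-- The inverse `q`-factorial, extended by zero to the negative integers. -/
def invFact (q : K) (z : ℤ) : K := if 0 ≤ z then (qFact q z.toNat)⁻¹ else 0

/-- The symmetric kernel `1 / ([n-k]! [n+k+1]!)`. -/
def kernel (q : K) (n : ℤ) (k : ℕ) : K := invFact q (n - k) * invFact q (n + k + 1)

/-- The `q`-binomial coefficient in terms of `q`-factorials. -/
def gauss (q : K) (n : ℕ) (k : ℤ) : K := qFact q n * invFact q k * invFact q (n - k)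

/-- `q` is non-zero and not a root of unity. -/
structure Generic (q : K) : Prop where
  ne_zero : q ≠ 0
  pow_ne_one : ∀ n : ℕ, 0 < n → q ^ n ≠ 1

variable {q : K}

lemma Generic.one_sub_ne_zero (hq : Generic q) : 1 - q ≠ 0 := by
  have := hq.pow_ne_one 1 one_pos
  rw [pow_one] at this
  exact sub_ne_zero.2 this.symm

lemma Generic.qNum_ne_zero (hq : Generic q) (n : ℕ) : qNum q ((n : ℤ) + 1) ≠ 0 := by
  refine div_ne_zero (sub_ne_zero.2 ?_) hq.one_sub_ne_zero
  have := hq.pow_ne_one (n + 1) n.succ_pos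
  exact_mod_cast this.symm

@[simp] lemma qNum_zero : qNum q 0 = 0 := by simp [qNum]

@[simp] lemma qFact_zero : qFact q 0 = 1 := by simp [qFact]

lemma qFact_succ (n : ℕ) : qFact q (n + 1) = qFact q n * qNum q ((n : ℤ) + 1) := by
  simp [qFact, Finset.prod_range_succ]

lemma Generic.qFact_ne_zero (hq : Generic q) (n : ℕ) : qFact q n ≠ 0 :=
  Finset.prod_ne_zero_iff.2 fun i _ => hq.qNum_ne_zero i

lemma invFact_of_neg {z : ℤ} (hz : z < 0) : invFact q z = 0 := by
  simp [invFact, not_le.2 hz]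

@[simp] lemma invFact_natCast (n : ℕ) : invFact q n = (qFact q n)⁻¹ := by simp [invFact]

lemma Generic.qFact_mul_invFact (hq : Generic q) (n : ℕ) : qFact q n * invFact q n = 1 := by
  rw [invFact_natCast, mul_inv_cancel₀ (hq.qFact_ne_zero n)]

/-- Extension by zero makes this hold at every integer, boundary `z = 0` included, so later
identities need no range conditions. -/
lemma Generic.qNum_mul_invFact (hq : Generic q) (z : ℤ) :
    qNum q z * invFact q z = invFact q (z - 1) := by
  rcases lt_trichotomy z 0 with h | rfl | h
  · rw [invFact_of_neg h, invFact_of_neg (by omega), mul_zero]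
  · rw [qNum_zero, zero_mul, invFact_of_neg (by omega)]
  · obtain ⟨n, rfl⟩ : ∃ n : ℕ, z = (n : ℤ) + 1 := ⟨(z - 1).toNat, by omega⟩
    have h1 : invFact q ((n : ℤ) + 1) = (qFact q (n + 1))⁻¹ := by
      rw [← invFact_natCast]; push_cast; rfl
    rw [add_sub_cancel_right, invFact_natCast, h1, qFact_succ]
    have := hq.qNum_ne_zero n
    have := hq.qFact_ne_zero n
    field_simp

lemma Generic.invFact_pred (hq : Generic q) {y z : ℤ} (h : y + 1 = z) :
    invFact q y = qNum q z * invFact q z := by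
  rw [hq.qNum_mul_invFact, ← h, add_sub_cancel_right]

lemma gauss_of_neg (n : ℕ) {k : ℤ} (hk : k < 0) : gauss q n k = 0 := by
  simp [gauss, invFact_of_neg hk]

lemma Generic.gauss_zero_right (hq : Generic q) (n : ℕ) : gauss q n 0 = 1 := by
  have : invFact q 0 = 1 := by simp [invFact]
  rw [gauss, this, mul_one, sub_zero, hq.qFact_mul_invFact]

lemma Generic.gauss_succ (hq : Generic q) (n : ℕ) (k : ℤ) :
    gauss q (n + 1) k = gauss q n (k - 1) + q ^ k * gauss q n k := by
  unfold gauss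
  rw [qFact_succ, hq.invFact_pred (y := k - 1) (z := k) (by ring),
    hq.invFact_pred (y := (n : ℤ) - k) (z := n + 1 - k) (by ring)]
  push_cast
  rw [show (n : ℤ) - (k - 1) = n + 1 - k by ring]
  have h0 := hq.ne_zero
  have h1 := hq.one_sub_ne_zero
  have : qNum q ((n : ℤ) + 1) = qNum q k + q ^ k * qNum q ((n : ℤ) + 1 - k) := by
    unfold qNum
    rw [zpow_sub₀ h0]
    have := zpow_ne_zero k h0
    field_simp
    ring
  rw [this]
  ring

/-- The `q`-Vandermonde identity. -/
lemma Generic.vandermonde (hq : Generic q) (M : ℕ) : ∀ N r : ℕ,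
    ∑ p ∈ Finset.HasAntidiagonal.antidiagonal r,
      q ^ (((N : ℤ) - p.1) * p.2) * gauss q N p.1 * gauss q M p.2 = gauss q (N + M) r := by
  intro N
  induction N with
  | zero =>
    intro r
    rw [Finset.sum_eq_single (0, r)]
    · simp [hq.gauss_zero_right]
    · rintro ⟨i, j⟩ _ hne
      have hi : 0 < i := by
        rcases Nat.eq_zero_or_pos i with rfl | h
        · simp_all
        · exact h
      have : gauss q 0 (i : ℤ) = 0 := by
        rw [gauss, invFact_of_neg (z := ((0 : ℕ) : ℤ) - i) (by omega), mul_zero]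
      simp [this]
    · simp
  | succ N ih =>
    intro r
    rw [show N + 1 + M = N + M + 1 by ring, hq.gauss_succ, ← ih r, Finset.mul_sum]
    have h0 := hq.ne_zero
    have hsplit : ∀ p ∈ Finset.HasAntidiagonal.antidiagonal r,
        q ^ ((((N + 1 : ℕ) : ℤ) - p.1) * p.2) * gauss q (N + 1) p.1 * gauss q M p.2
        = q ^ (((N : ℤ) + 1 - p.1) * p.2) * gauss q N ((p.1 : ℤ) - 1) * gauss q M p.2
          + q ^ (r : ℤ) * (q ^ (((N : ℤ) - p.1) * p.2) * gauss q N p.1 * gauss q M p.2) := by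
      rintro ⟨i, j⟩ hp
      have hr : r = i + j := (Finset.HasAntidiagonal.mem_antidiagonal.1 hp).symm
      subst hr
      simp only
      rw [hq.gauss_succ]
      push_cast
      rw [show ((N : ℤ) + 1 - i) * j = (N - i) * j + j by ring, zpow_add₀ h0, zpow_add₀ h0]
      ring
    rw [Finset.sum_congr rfl hsplit, Finset.sum_add_distrib]
    congr 1
    -- Pascal's shifted term becomes the induction hypothesis at `r - 1`, since the `i = 0` term
    -- vanishes.
    cases r with
    | zero => simp [gauss_of_neg]
    | succ r =>
      rw [Finset.Nat.antidiagonal_succ, Finset.sum_cons, Finset.sum_map]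
      simp only [Nat.cast_zero, zero_sub, gauss_of_neg (q := q) N (show (-1 : ℤ) < 0 by norm_num),
        mul_zero, zero_mul, zero_add]
      push_cast
      rw [add_sub_cancel_right, ← ih r]
      refine Finset.sum_congr rfl fun p _ => ?_
      simp only [Function.Embedding.prodMap, Function.Embedding.coeFn_mk, Prod.map,
        Function.Embedding.refl_apply, Nat.succ_eq_add_one]
      push_cast
      rw [add_sub_cancel_right, show (N : ℤ) + 1 - (p.1 + 1) = N - p.1 by ring]

/-! ### Linearization of products of kernels -/

lemma kernel_of_lt {n : ℤ} {k : ℕ} (h : n < k) : kernel q n k = 0 := by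
  rw [kernel, invFact_of_neg (by omega), zero_mul]

lemma sum_antidiagonal_eq_sum_range_shift (f : ℤ → ℤ → K) (n k : ℕ) (hk : k ≤ n)
    (hf : ∀ i j, i < 0 → f i j = 0) :
    ∑ p ∈ Finset.HasAntidiagonal.antidiagonal (n - k), f p.1 p.2
      = ∑ s ∈ Finset.range (n + 1), f ((s : ℤ) - k) ((n : ℤ) - s) := by
  rw [Finset.Nat.sum_antidiagonal_eq_sum_range_succ (fun i j => f i j),
    show n + 1 = k + (n - k + 1) by omega, Finset.sum_range_add,
    Finset.sum_eq_zero (s := Finset.range k), zero_add]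
  · refine Finset.sum_congr rfl fun i hi => ?_
    have := Finset.mem_range.1 hi
    congr 1 <;> omega
  · intro s hs
    have := Finset.mem_range.1 hs
    exact hf _ _ (by omega)

/-- Linearization of a product of two kernels. -/
lemma Generic.kernel_mul (hq : Generic q) (n x k : ℕ) :
    qFact q (n + x + 1) * (kernel q n k * kernel q x k)
      = ∑ s ∈ Finset.range (n + 1), q ^ (((n : ℤ) - s) * ((x : ℤ) - s))
          * (invFact q ((n : ℤ) - s) * invFact q ((x : ℤ) - s)) * kernel q s k := by
  by_cases hk : k ≤ n ∧ k ≤ x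
  swap
  · rw [Finset.sum_eq_zero]
    · rcases not_and_or.1 hk with h | h
      · rw [kernel_of_lt (n := (n : ℤ)) (by omega)]; ring
      · rw [kernel_of_lt (n := (x : ℤ)) (by omega)]; ring
    · intro s hs
      have := Finset.mem_range.1 hs
      by_cases h : k ≤ s
      · rw [invFact_of_neg (z := (x : ℤ) - s) (by omega)]; ring
      · rw [kernel_of_lt (n := (s : ℤ)) (by omega)]; ring
  obtain ⟨hn, hx⟩ := hk
  have h := hq.vandermonde (n + k + 1) (x - k) (n - k)
  rw [sum_antidiagonal_eq_sum_range_shift (fun i j => q ^ ((((x - k : ℕ) : ℤ) - i) * j)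
    * gauss q (x - k) i * gauss q (n + k + 1) j) n k hn
    (fun i j hi => by rw [gauss_of_neg _ hi]; ring)] at h
  unfold gauss at h
  rw [show x - k + (n + k + 1) = n + x + 1 by omega] at h
  have e1 := hq.qFact_mul_invFact (x - k)
  have e2 := hq.qFact_mul_invFact (n + k + 1)
  push_cast [hn, hx] at h e1 e2
  rw [show (n : ℤ) + x + 1 - (n - k) = x + k + 1 by ring] at h
  unfold kernel
  calc _ = qFact q (n + x + 1) * invFact q (n - k) * invFact q (x + k + 1)
        * (invFact q (x - k) * invFact q (n + k + 1)) := by ring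
    _ = _ := by
      rw [← h, Finset.sum_mul]
      refine Finset.sum_congr rfl fun s _ => ?_
      rw [show (x : ℤ) - k - (s - k) = x - s by ring,
        show (n : ℤ) + k + 1 - (n - s) = s + k + 1 by ring]
      calc _ = q ^ (((x : ℤ) - s) * ((n : ℤ) - s)) * invFact q (s - k) * invFact q (x - s)
              * invFact q (n - s) * invFact q (s + k + 1)
              * (qFact q (x - k) * invFact q (x - k))
              * (qFact q (n + k + 1) * invFact q (n + k + 1)) := by ring
        _ = _ := by rw [e1, e2, mul_comm ((x : ℤ) - s)]; ring

/-- Linearization of a product of two kernels, absorbing a power `q ^ (k² + k)`. -/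
lemma Generic.kernel_mul' (hq : Generic q) (n x k : ℕ) :
    qFact q (n + x + 1) * (q ^ (k ^ 2 + k) * (kernel q n k * kernel q x k))
      = ∑ s ∈ Finset.range (n + 1), q ^ (s ^ 2 + s)
          * (invFact q ((n : ℤ) - s) * invFact q ((x : ℤ) - s)) * kernel q s k := by
  by_cases hk : k ≤ n ∧ k ≤ x
  swap
  · rw [Finset.sum_eq_zero]
    · rcases not_and_or.1 hk with h | h
      · rw [kernel_of_lt (n := (n : ℤ)) (by omega)]; ring
      · rw [kernel_of_lt (n := (x : ℤ)) (by omega)]; ring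
    · intro s hs
      have := Finset.mem_range.1 hs
      by_cases h : k ≤ s
      · rw [invFact_of_neg (z := (x : ℤ) - s) (by omega)]; ring
      · rw [kernel_of_lt (n := (s : ℤ)) (by omega)]; ring
  obtain ⟨hn, hx⟩ := hk
  -- With the two blocks exchanged, the Vandermonde exponent becomes `(s+k+1)(s-k) = (s²+s) -
  -- (k²+k)`, which cancels the extra power.
  have h := hq.vandermonde (x - k) (n + k + 1) (n - k)
  rw [← Finset.sum_equiv (Equiv.prodComm ℕ ℕ) (s := Finset.HasAntidiagonal.antidiagonal (n - k))
    (f := fun p => q ^ ((((n + k + 1 : ℕ) : ℤ) - p.2) * p.1)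
      * gauss q (n + k + 1) p.2 * gauss q (x - k) p.1)
    (by intro p; simp [add_comm]) (by intro p _; rfl)] at h
  rw [sum_antidiagonal_eq_sum_range_shift (fun i j => q ^ ((((n + k + 1 : ℕ) : ℤ) - j) * i)
    * gauss q (n + k + 1) j * gauss q (x - k) i) n k hn
    (fun i j hi => by rw [gauss_of_neg _ hi]; ring)] at h
  unfold gauss at h
  rw [show n + k + 1 + (x - k) = n + x + 1 by omega] at h
  have e1 := hq.qFact_mul_invFact (x - k)
  have e2 := hq.qFact_mul_invFact (n + k + 1)
  push_cast [hn, hx] at h e1 e2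
  rw [show (n : ℤ) + x + 1 - (n - k) = x + k + 1 by ring] at h
  unfold kernel
  calc _ = q ^ (k ^ 2 + k) * (qFact q (n + x + 1) * invFact q (n - k) * invFact q (x + k + 1))
        * (invFact q (x - k) * invFact q (n + k + 1)) := by ring
    _ = _ := by
      rw [← h, Finset.mul_sum, Finset.sum_mul]
      refine Finset.sum_congr rfl fun s _ => ?_
      rw [show (x : ℤ) - k - (s - k) = x - s by ring,
        show (n : ℤ) + k + 1 - (n - s) = s + k + 1 by ring]
      have hpow : q ^ (k ^ 2 + k) * q ^ (((s : ℤ) + k + 1) * (s - k)) = q ^ (s ^ 2 + s) := by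
        rw [← zpow_natCast, ← zpow_natCast, ← zpow_add₀ hq.ne_zero]
        congr 1
        push_cast
        ring
      rw [← hpow]
      calc _ = q ^ (k ^ 2 + k) * q ^ (((s : ℤ) + k + 1) * (s - k))
              * invFact q (s - k) * invFact q (x - s)
              * invFact q (n - s) * invFact q (s + k + 1)
              * (qFact q (x - k) * invFact q (x - k))
              * (qFact q (n + k + 1) * invFact q (n + k + 1)) := by ring
        _ = _ := by rw [e1, e2]; ring

/-! ### Integrality of single-kernel sums -/

/-- A subring containing `q` and its inverse. -/
structure Adapted (R : Subring K) (q : K) : Prop where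
  mem : q ∈ R
  inv_mem : q⁻¹ ∈ R

lemma Adapted.zpow_mem {R : Subring K} (hR : Adapted R q) (z : ℤ) : q ^ z ∈ R := by
  cases z with
  | ofNat n => simpa using R.pow_mem hR.mem n
  | negSucc n =>
    rw [zpow_negSucc, ← inv_pow]
    exact R.pow_mem hR.inv_mem _

lemma Adapted.qNum_mem {R : Subring K} (hR : Adapted R q) (hq : Generic q) (n : ℕ) :
    qNum q n ∈ R := by
  have : qNum q n = ∑ i ∈ Finset.range n, q ^ i := by
    have h := mul_neg_geom_sum q n
    rw [qNum, zpow_natCast, div_eq_iff hq.one_sub_ne_zero, ← h, mul_comm]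
  rw [this]
  exact R.sum_mem fun i _ => R.pow_mem hR.mem i

lemma Adapted.qFact_mem {R : Subring K} (hR : Adapted R q) (hq : Generic q) (n : ℕ) :
    qFact q n ∈ R := by
  refine R.prod_mem fun i _ => ?_
  have := hR.qNum_mem hq (i + 1)
  rwa [Nat.cast_succ] at this

lemma Adapted.gauss_mem {R : Subring K} (hR : Adapted R q) (hq : Generic q) (n : ℕ) (k : ℤ) :
    gauss q n k ∈ R := by
  induction n generalizing k with
  | zero =>
    rcases lt_trichotomy k 0 with h | rfl | h
    · rw [gauss_of_neg _ h]; exact R.zero_mem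
    · rw [hq.gauss_zero_right]; exact R.one_mem
    · rw [gauss, invFact_of_neg (z := ((0 : ℕ) : ℤ) - k) (by push_cast; omega), mul_zero]
      exact R.zero_mem
  | succ n ih =>
    rw [hq.gauss_succ]
    exact R.add_mem (ih _) (R.mul_mem (hR.zpow_mem _) (ih _))

/-- The sums `[n]!² ∑ w_k q^(j(k²+k)) / ([n-k]! [n+k+1]!)` all lie in `R`. -/
def IntegralWeight (R : Subring K) (q : K) (w : ℕ → K) (j : ℕ) : Prop :=
  ∀ N n : ℕ, n < N →
    qFact q n ^ 2 * ∑ k ∈ Finset.range N, w k * q ^ (j * (k ^ 2 + k)) * kernel q n k ∈ R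

lemma Generic.qNum_mul_kernel (hq : Generic q) (n : ℤ) (k : ℕ) :
    qNum q (n - k) * qNum q (n + k + 1) * kernel q n k = kernel q (n - 1) k := by
  rw [kernel, kernel, hq.invFact_pred (y := n - 1 - k) (z := n - k) (by ring),
    hq.invFact_pred (y := n - 1 + k + 1) (z := n + k + 1) (by ring)]
  ring

/-- With `u = q^(-k) + q^(k+1)`, the factor `(1-q)² q^(-2k)[2k+1]²` equals `u² - 4q`, while
`[n-k][n+k+1]` is affine in `u` and lowers the kernel index by one. A quadratic in `u` thus reaches
two indices down. -/
lemma Generic.sq_mul_kernel (hq : Generic q) (n : ℤ) (k : ℕ) :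
    q ^ (-(2 * k) : ℤ) * qNum q (2 * k + 1) ^ 2 * kernel q n k
      = q ^ (-(2 * n)) * (qNum q (2 * n + 1) ^ 2 * kernel q n k
        + ((1 - q) ^ 2 * qNum q (2 * n) - 2 * (1 + q ^ (2 * n + 1))) * kernel q (n - 1) k
        + (1 - q) ^ 2 * q * kernel q (n - 2) k) := by
  have h2 := hq.qNum_mul_kernel (n - 1) k
  rw [show n - 1 - 1 = n - 2 by ring] at h2
  rw [← h2, ← hq.qNum_mul_kernel n k]
  have h0 := hq.ne_zero
  have h1 := hq.one_sub_ne_zero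
  have e : ∀ a b : ℤ, q ^ (2 * a) = (q ^ a) ^ 2 := fun a _ => by
    rw [mul_comm, zpow_mul, zpow_ofNat]
  have hx := zpow_ne_zero n h0
  have hy := pow_ne_zero k h0
  simp only [← mul_assoc, ← add_mul]
  congr 1
  unfold qNum
  simp only [zpow_sub₀ h0, zpow_add₀ h0, zpow_neg, e _ 0, zpow_one, zpow_natCast]
  generalize q ^ n = x at *
  generalize q ^ k = y at *
  field_simp
  ring

lemma IntegralWeight.mul_sq {R : Subring K} (hR : Adapted R q) (hq : Generic q) {w : ℕ → K}
    {j : ℕ} (h : IntegralWeight R q w j) :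
    IntegralWeight R q
      (fun k => w k * (q ^ (-(2 * k) : ℤ) * qNum q (2 * k + 1) ^ 2)) j := by
  intro N n hn
  set S : ℤ → K := fun m => ∑ k ∈ Finset.range N, w k * q ^ (j * (k ^ 2 + k)) * kernel q m k
    with hS
  have hsum : ∑ k ∈ Finset.range N, w k * (q ^ (-(2 * k) : ℤ) * qNum q (2 * k + 1) ^ 2)
        * q ^ (j * (k ^ 2 + k)) * kernel q n k
      = q ^ (-(2 * n : ℤ)) * (qNum q (2 * n + 1) ^ 2 * S n
        + ((1 - q) ^ 2 * qNum q (2 * n) - 2 * (1 + q ^ (2 * n + 1 : ℤ))) * S (n - 1)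
        + (1 - q) ^ 2 * q * S (n - 2)) := by
    simp only [hS, Finset.mul_sum, ← Finset.sum_add_distrib]
    refine Finset.sum_congr rfl fun k _ => ?_
    linear_combination w k * q ^ (j * (k ^ 2 + k)) * hq.sq_mul_kernel n k
  have hneg : ∀ m : ℤ, m < 0 → S m = 0 := fun m hm =>
    Finset.sum_eq_zero fun k _ => by rw [kernel_of_lt (by omega), mul_zero]
  -- Lowering the index is harmless because `[n-i]!` divides `[n]!` in `R`.
  have hstep : ∀ i : ℕ, qFact q n ^ 2 * S (n - i) ∈ R := by
    intro i
    by_cases hi : i ≤ n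
    · obtain ⟨m, rfl⟩ := Nat.exists_eq_add_of_le' hi
      have hm := h N m (by omega)
      have hc : ∃ c ∈ R, qFact q (m + i) = c * qFact q m := by
        refine ⟨∏ l ∈ Finset.range i, qNum q (((m + l : ℕ) : ℤ) + 1), R.prod_mem fun l _ => ?_, ?_⟩
        · exact_mod_cast hR.qNum_mem hq (m + l + 1)
        · rw [qFact, Finset.prod_range_add, qFact, mul_comm]
      obtain ⟨c, hc, e⟩ := hc
      rw [e, mul_pow, mul_assoc, show ((m + i : ℕ) : ℤ) - i = m by push_cast; ring]
      exact R.mul_mem (R.pow_mem hc 2) hm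
    · rw [hneg _ (by omega), mul_zero]
      exact R.zero_mem
  rw [hsum]
  have t0 := hstep 0
  have t1 := hstep 1
  have t2 := hstep 2
  simp only [Nat.cast_zero, sub_zero, Nat.cast_one, Nat.cast_ofNat] at t0 t1 t2
  have m1 : qNum q (2 * n + 1) ∈ R := by exact_mod_cast hR.qNum_mem hq (2 * n + 1)
  have m2 : qNum q (2 * n) ∈ R := by exact_mod_cast hR.qNum_mem hq (2 * n)
  have m3 : 1 - q ∈ R := R.sub_mem R.one_mem hR.mem
  have m4 : (2 : K) ∈ R := ofNat_mem R 2
  have : ∀ a b c d : K, qFact q n ^ 2 * (a * (b * S n + c * S (n - 1) + d * S (n - 2)))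
      = a * (b * (qFact q n ^ 2 * S n) + c * (qFact q n ^ 2 * S (n - 1))
        + d * (qFact q n ^ 2 * S (n - 2))) := by intros; ring
  rw [this]
  refine R.mul_mem (hR.zpow_mem _) (R.add_mem (R.add_mem (R.mul_mem (R.pow_mem m1 2) t0)
    (R.mul_mem ?_ t1)) (R.mul_mem (R.mul_mem (R.pow_mem m3 2) hR.mem) t2))
  exact R.sub_mem (R.mul_mem (R.pow_mem m3 2) m2)
    (R.mul_mem m4 (R.add_mem R.one_mem (hR.zpow_mem _)))

/-- A telescoping sum of terms over `1 / ([n-k]! [n+k]!)`. -/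
lemma Generic.sum_kernel_telescope (hq : Generic q) {N n : ℕ} (hn : n < N) (f g : ℕ → K)
    (h : ∀ k : ℕ, g k * kernel q n k
      = (f k * qNum q (n + k + 1) - f (k + 1) * qNum q (n - k)) * kernel q n k) :
    ∑ k ∈ Finset.range N, g k * kernel q n k = f 0 * (invFact q n) ^ 2 := by
  have h' : ∀ k ∈ Finset.range N, g k * kernel q n k
      = f k * (invFact q ((n : ℤ) - k) * invFact q (n + k))
        - f (k + 1) * (invFact q ((n : ℤ) - (k + 1 : ℕ)) * invFact q (n + (k + 1 : ℕ))) := by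
    intro k _
    rw [h, kernel, hq.invFact_pred (y := (n : ℤ) + k) (z := n + k + 1) (by ring),
      hq.invFact_pred (y := (n : ℤ) - (k + 1 : ℕ)) (z := n - k) (by push_cast; ring)]
    push_cast
    rw [← add_assoc]
    ring
  rw [Finset.sum_congr rfl h', Finset.sum_range_sub',
    invFact_of_neg (z := (n : ℤ) - N) (by omega)]
  simp [sq]

lemma Generic.sq_qFact_mul (hq : Generic q) (n : ℕ) (x : K) :
    qFact q n ^ 2 * (x * invFact q n ^ 2) = x := by
  have := hq.qFact_mul_invFact n
  calc _ = x * (qFact q n * invFact q n) ^ 2 := by ring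
    _ = x := by rw [this]; ring

lemma choose_two_succ (k : ℕ) : (k + 1).choose 2 = k.choose 2 + k := by
  rw [Nat.choose_succ_succ' k 1, Nat.choose_one_right, add_comm]

/-- Both sums telescope; the normalized values are `q^(-n)` for `j = 0` and `1` for `j = 1`. -/
lemma integralWeight_pos {R : Subring K} (hR : Adapted R q) (hq : Generic q) {j : ℕ}
    (hj : j ≤ 1) : IntegralWeight R q (fun k => q ^ (-(k : ℤ)) * qNum q (2 * k + 1)) j := by
  intro N n hn
  have h0 := hq.ne_zero
  have h1 := hq.one_sub_ne_zero
  have hx := zpow_ne_zero n h0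
  have e : ∀ a b : ℤ, q ^ (2 * a) = (q ^ a) ^ 2 := fun a _ => by
    rw [mul_comm, zpow_mul, zpow_ofNat]
  have key : ∀ f : ℕ → K, f 0 ∈ R → (∀ k : ℕ,
      q ^ (-(k : ℤ)) * qNum q (2 * k + 1) * q ^ (j * (k ^ 2 + k))
        = f k * qNum q (n + k + 1) - f (k + 1) * qNum q (n - k)) →
      qFact q n ^ 2 * ∑ k ∈ Finset.range N, q ^ (-(k : ℤ)) * qNum q (2 * k + 1)
        * q ^ (j * (k ^ 2 + k)) * kernel q n k ∈ R := by
    intro f hf h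
    rw [hq.sum_kernel_telescope hn f _ fun k => by rw [h], hq.sq_qFact_mul]
    exact hf
  rcases Nat.le_one_iff_eq_zero_or_eq_one.1 hj with rfl | rfl
  · refine key (fun _ => q ^ (-(n : ℤ))) (hR.zpow_mem _) fun k => ?_
    have hy := pow_ne_zero k h0
    unfold qNum
    simp only [zpow_sub₀ h0, zpow_add₀ h0, zpow_neg, e _ 0, zpow_one, zpow_natCast, zero_mul,
      pow_zero]
    field_simp
    ring
  · refine key (fun k => q ^ (k ^ 2)) (by simp [R.one_mem]) fun k => ?_
    have hy := pow_ne_zero k h0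
    unfold qNum
    simp only [zpow_sub₀ h0, zpow_add₀ h0, zpow_neg, e _ 0, zpow_one, zpow_natCast, one_mul,
      pow_add, show (k + 1) ^ 2 = k ^ 2 + (k + k) + 1 by ring]
    field_simp
    ring

/-- The sum is 1 at `n = 0`; for `n > 0` it telescopes to 0, the primitive carrying the factor
`[k]`. -/
lemma integralWeight_alt_zero (R : Subring K) (hq : Generic q) :
    IntegralWeight R q (fun k => (-1) ^ k * q ^ (k.choose 2) * qNum q (2 * k + 1)) 0 := by
  intro N n hn
  have h0 := hq.ne_zero
  have h1 := hq.one_sub_ne_zero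
  have e : ∀ a b : ℤ, q ^ (2 * a) = (q ^ a) ^ 2 := fun a _ => by
    rw [mul_comm, zpow_mul, zpow_ofNat]
  cases n with
  | zero =>
    rw [Finset.sum_eq_single_of_mem 0 (by simpa using hn)]
    · have hs := hq.qNum_ne_zero 0
      simp only [Nat.cast_zero, zero_add] at hs
      have : invFact q 1 = (qNum q 1)⁻¹ := by
        have := invFact_natCast (q := q) 1
        rw [show (1 : ℕ) = 0 + 1 from rfl, qFact_succ] at this
        simpa using this
      have h00 : invFact q 0 = 1 := by simp [invFact]
      simp [kernel, this, h00, hs, R.one_mem]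
    · intro k _ hk
      rw [kernel_of_lt (by omega), mul_zero]
  | succ n =>
    have hs := hq.qNum_ne_zero n
    rw [hq.sum_kernel_telescope hn
      (fun k => (-1) ^ k * q ^ (k.choose 2) * qNum q k / qNum q ((n : ℤ) + 1)) _ fun k => ?_]
    · simp [R.zero_mem]
    · congr 1
      have hs' : 1 - q ^ n * q ≠ 0 := by
        intro h
        apply hs
        rw [qNum, zpow_add₀ h0, zpow_natCast, zpow_one, h, zero_div]
      have hy := pow_ne_zero k h0
      rw [choose_two_succ]
      unfold qNum
      push_cast
      simp only [zpow_sub₀ h0, zpow_add₀ h0, e _ 0, zpow_one, zpow_natCast, zero_mul,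
        pow_zero, pow_add, pow_one]
      have hx := pow_ne_zero n h0
      have hs2 : 1 - q * q ^ n ≠ 0 := by rwa [mul_comm]
      clear hs
      generalize q ^ n = x at *
      generalize q ^ k = y at *
      field_simp
      ring

lemma Generic.sum_alt_one (hq : Generic q) {N n : ℕ} (hn : n < N) :
    qFact q n * ∑ k ∈ Finset.range N, (-1) ^ k * q ^ (k.choose 2) * qNum q (2 * k + 1)
      * q ^ (k ^ 2 + k) * kernel q n k = (1 - q) ^ n := by
  have h0 := hq.ne_zero
  have h1 := hq.one_sub_ne_zero
  have e : ∀ a b : ℤ, q ^ (2 * a) = (q ^ a) ^ 2 := fun a _ => by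
    rw [mul_comm, zpow_mul, zpow_ofNat]
  induction n with
  | zero =>
    rw [Finset.sum_eq_single_of_mem 0 (by simpa using hn)]
    · have hs := hq.qNum_ne_zero 0
      simp only [Nat.cast_zero, zero_add] at hs
      have : invFact q 1 = (qNum q 1)⁻¹ := by
        have := invFact_natCast (q := q) 1
        rw [show (1 : ℕ) = 0 + 1 from rfl, qFact_succ] at this
        simpa using this
      have h00 : invFact q 0 = 1 := by simp [invFact]
      simp [kernel, this, h00, hs]
    · intro k _ hk
      rw [kernel_of_lt (by omega), mul_zero]
  | succ n ih =>
    have ih := ih (by omega)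
    have hs := hq.qNum_ne_zero n
    -- The bracket is chosen so that the sum telescopes to 0; its product `[n+1-k][n+k+2]` lowers
    -- the kernel to index `n`, giving a first-order recursion.
    have ht := hq.sum_kernel_telescope hn
      (fun k => (-1) ^ k * q ^ (k.choose 2) * q ^ (k ^ 2 + k) * q ^ (n + 1)
        * q ^ (-(k : ℤ)) * qNum q k)
      (fun k => (-1) ^ k * q ^ (k.choose 2) * qNum q (2 * k + 1) * q ^ (k ^ 2 + k)
        * (qNum q ((n : ℤ) + 1)
          - (1 - q) * (qNum q (((n + 1 : ℕ) : ℤ) - k) * qNum q (((n + 1 : ℕ) : ℤ) + k + 1))))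
      fun k => by
        congr 1
        have hy := pow_ne_zero k h0
        rw [choose_two_succ]
        unfold qNum
        push_cast
        simp only [zpow_sub₀ h0, zpow_add₀ h0, zpow_neg, e _ 0, zpow_one, zpow_natCast,
          pow_add, pow_one, show (k + 1) ^ 2 = k ^ 2 + (k + k) + 1 by ring]
        field_simp
        ring
    simp only [Nat.cast_zero, qNum_zero, mul_zero, zero_mul] at ht
    have hsplit : ∀ k ∈ Finset.range N,
        (-1) ^ k * q ^ (k.choose 2) * qNum q (2 * k + 1) * q ^ (k ^ 2 + k)
        * (qNum q ((n : ℤ) + 1)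
          - (1 - q) * (qNum q (((n + 1 : ℕ) : ℤ) - k) * qNum q (((n + 1 : ℕ) : ℤ) + k + 1)))
          * kernel q ((n + 1 : ℕ) : ℤ) k
        = qNum q ((n : ℤ) + 1) * ((-1) ^ k * q ^ (k.choose 2) * qNum q (2 * k + 1)
            * q ^ (k ^ 2 + k) * kernel q ((n + 1 : ℕ) : ℤ) k)
          - (1 - q) * ((-1) ^ k * q ^ (k.choose 2) * qNum q (2 * k + 1)
            * q ^ (k ^ 2 + k) * kernel q n k) := by
      intro k _
      have := hq.qNum_mul_kernel ((n + 1 : ℕ) : ℤ) k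
      rw [show ((n + 1 : ℕ) : ℤ) - 1 = n by push_cast; ring] at this
      rw [← this]
      ring
    rw [Finset.sum_congr rfl hsplit, Finset.sum_sub_distrib, ← Finset.mul_sum,
      ← Finset.mul_sum, sub_eq_zero] at ht
    rw [qFact_succ, mul_assoc, ht, pow_succ, ← ih]
    ring

lemma integralWeight_alt {R : Subring K} (hR : Adapted R q) (hq : Generic q) {j : ℕ}
    (hj : j ≤ 1) :
    IntegralWeight R q (fun k => (-1) ^ k * q ^ (k.choose 2) * qNum q (2 * k + 1)) j := by
  rcases Nat.le_one_iff_eq_zero_or_eq_one.1 hj with rfl | rfl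
  · exact integralWeight_alt_zero R hq
  · intro N n hn
    simp only [one_mul]
    rw [sq, mul_assoc, hq.sum_alt_one hn]
    exact R.mul_mem (hR.qFact_mem hq n) (R.pow_mem (R.sub_mem R.one_mem hR.mem) n)

/-! ### Sums along a sequence of kernels -/

/-- The product of the `[m+m'+1]!` over the consecutive entries `m, m'` of the sequence
`n, l, t`. -/
def pathFact (q : K) (t : ℕ) : ℕ → List ℕ → K
  | n, [] => qFact q (n + t + 1)
  | n, x :: l => qFact q (n + x + 1) * pathFact q t x l

lemma exists_pathFact_eq (t : ℕ) (l : List ℕ) :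
    ∃ (y : ℕ) (c : K), ∀ x, pathFact q t x l = qFact q (x + y + 1) * c := by
  cases l with
  | nil => exact ⟨t, 1, fun x => by simp [pathFact]⟩
  | cons y l => exact ⟨y, pathFact q t y l, fun x => rfl⟩

lemma pathFact_replicate_append (t x a : ℕ) (l : List ℕ) :
    pathFact q t x (List.replicate a x ++ l) = qFact q (2 * x + 1) ^ a * pathFact q t x l := by
  induction a with
  | zero => simp
  | succ a ih =>
    rw [List.replicate_succ, List.cons_append, pathFact, ih, ← two_mul]
    ring

lemma pathFact_replicate_end (t x a : ℕ) :
    pathFact q t x (List.replicate a t) = qFact q (x + t + 1) * qFact q (2 * t + 1) ^ a := by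
  induction a generalizing x with
  | zero => simp [pathFact]
  | succ a ih =>
    rw [List.replicate_succ, pathFact, ih, ← two_mul]
    ring

lemma Generic.qFact_mul_invFact_sub (hq : Generic q) (n s : ℕ) :
    qFact q n * invFact q ((n : ℤ) - s) = gauss q n s * qFact q s := by
  have := hq.qFact_mul_invFact s
  rw [gauss]
  linear_combination (-(qFact q n * invFact q ((n : ℤ) - s))) * this

/-- Truncated `j - 1` unites the two linearizations: the plain one at `j = 0`, the absorbing one
otherwise. -/
lemma Generic.linearize_sum (hq : Generic q) (w E : ℕ → K) (j N n x : ℕ) :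
    ∃ e : ℕ → ℤ, qFact q (n + x + 1) * ∑ k ∈ Finset.range N,
        w k * q ^ (j * (k ^ 2 + k)) * (kernel q n k * (kernel q x k * E k))
      = ∑ s ∈ Finset.range (n + 1), q ^ e s
          * (invFact q ((n : ℤ) - s) * invFact q ((x : ℤ) - s))
          * ∑ k ∈ Finset.range N, w k * q ^ ((j - 1) * (k ^ 2 + k)) * (kernel q s k * E k) := by
  cases j with
  | zero =>
    refine ⟨fun s => ((n : ℤ) - s) * ((x : ℤ) - s), ?_⟩
    simp only [Finset.mul_sum]
    rw [Finset.sum_comm]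
    refine Finset.sum_congr rfl fun k _ => ?_
    calc _ = w k * q ^ (0 * (k ^ 2 + k)) * E k
          * (qFact q (n + x + 1) * (kernel q n k * kernel q x k)) := by ring
      _ = _ := by
        rw [hq.kernel_mul, Finset.mul_sum]
        exact Finset.sum_congr rfl fun s _ => by ring
  | succ j =>
    refine ⟨fun s => ((s ^ 2 + s : ℕ) : ℤ), ?_⟩
    simp only [Finset.mul_sum, zpow_natCast]
    rw [Finset.sum_comm]
    refine Finset.sum_congr rfl fun k _ => ?_
    rw [Nat.add_sub_cancel, add_mul, one_mul, pow_add q (j * _)]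
    calc _ = w k * q ^ (j * (k ^ 2 + k)) * E k
          * (qFact q (n + x + 1) * (q ^ (k ^ 2 + k) * (kernel q n k * kernel q x k))) := by ring
      _ = _ := by
        rw [hq.kernel_mul', Finset.mul_sum]
        exact Finset.sum_congr rfl fun s _ => by ring

/-- Integrality of the sums attached to a sequence `n, l, t`. -/
theorem path_sum_mem {R : Subring K} (hR : Adapted R q) (hq : Generic q) {w : ℕ → K}
    (hw : ∀ j ≤ 1, IntegralWeight R q w j) (t : ℕ) (l : List ℕ) :
    ∀ N n j : ℕ, n < N → j ≤ l.length + 2 →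
      qFact q n * qFact q t * pathFact q t n l
        * ∑ k ∈ Finset.range N, w k * q ^ (j * (k ^ 2 + k))
          * (kernel q n k * ((l.map fun m : ℕ => kernel q m k).prod * kernel q t k)) ∈ R := by
  induction l with
  | nil =>
    intro N n j hn hj
    obtain ⟨e, he⟩ := hq.linearize_sum w (fun _ => 1) j N n t
    simp only [mul_one] at he
    simp only [List.map_nil, List.prod_nil, one_mul, pathFact]
    rw [mul_assoc, he, Finset.mul_sum]
    refine R.sum_mem fun s hs => ?_
    have hs := Finset.mem_range.1 hs
    have h := hw (j - 1) (by simp at hj; omega) N s (by omega)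
    have h1 := hq.qFact_mul_invFact_sub n s
    have h2 := hq.qFact_mul_invFact_sub t s
    set T := ∑ k ∈ Finset.range N, w k * q ^ ((j - 1) * (k ^ 2 + k)) * kernel q s k
    have : qFact q n * qFact q t * (q ^ e s
          * (invFact q ((n : ℤ) - s) * invFact q ((t : ℤ) - s)) * T)
        = q ^ e s * (gauss q n s * gauss q t s * (qFact q s ^ 2 * T)) := by
      calc _ = q ^ e s * (qFact q n * invFact q ((n : ℤ) - s))
              * (qFact q t * invFact q ((t : ℤ) - s)) * T := by ring
        _ = _ := by rw [h1, h2]; ring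
    rw [this]
    exact R.mul_mem (hR.zpow_mem _)
      (R.mul_mem (R.mul_mem (hR.gauss_mem hq _ _) (hR.gauss_mem hq _ _)) h)
  | cons x l ih =>
    intro N n j hn hj
    obtain ⟨e, he⟩ := hq.linearize_sum w
      (fun k => (l.map fun m : ℕ => kernel q m k).prod * kernel q t k) j N n x
    simp only [List.map_cons, List.prod_cons, pathFact, mul_assoc] at he ⊢
    rw [mul_left_comm (qFact q (n + x + 1)), he, Finset.mul_sum, Finset.mul_sum, Finset.mul_sum]
    refine R.sum_mem fun s hs => ?_
    have hs := Finset.mem_range.1 hs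
    have h := ih N s (j - 1) (by omega) (by simp at hj; omega)
    simp only [mul_assoc] at h
    set T := ∑ k ∈ Finset.range N, w k * (q ^ ((j - 1) * (k ^ 2 + k)) * (kernel q s k *
      ((l.map fun m : ℕ => kernel q m k).prod * kernel q t k)))
    by_cases hsx : s ≤ x
    swap
    · rw [invFact_of_neg (z := (x : ℤ) - s) (by omega)]
      simp [R.zero_mem]
    have h1 := hq.qFact_mul_invFact_sub n s
    obtain ⟨y, c, hc⟩ := exists_pathFact_eq (q := q) t l
    have h2 := hq.qFact_mul_invFact (s + y + 1)
    -- Here `y` is the entry after `x`: the adjacent factorial turns into the one for the shortened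
    -- sequence starting at `s`, at the cost of a Gaussian binomial.
    have h3 : qFact q (x + y + 1) * invFact q ((x : ℤ) - s)
        = gauss q (x + y + 1) ((x : ℤ) - s) * qFact q (s + y + 1) := by
      rw [gauss, show ((x + y + 1 : ℕ) : ℤ) - (x - s) = ((s + y + 1 : ℕ) : ℤ) by push_cast; ring]
      linear_combination (-(qFact q (x + y + 1) * invFact q ((x : ℤ) - s))) * h2
    rw [hc] at h ⊢
    have : qFact q n * (qFact q t * (qFact q (x + y + 1) * c * (q ^ e s
          * (invFact q ((n : ℤ) - s) * (invFact q ((x : ℤ) - s) * T)))))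
        = q ^ e s * (gauss q n s * gauss q (x + y + 1) ((x : ℤ) - s)
          * (qFact q s * (qFact q t * (qFact q (s + y + 1) * c * T)))) := by
      calc _ = q ^ e s * (qFact q n * invFact q ((n : ℤ) - s))
              * (qFact q (x + y + 1) * invFact q ((x : ℤ) - s)) * qFact q t * c * T := by ring
        _ = _ := by rw [h1, h3]; ring
    simp only [mul_assoc] at this h ⊢
    rw [this]
    refine R.mul_mem (hR.zpow_mem _) (R.mul_mem (hR.gauss_mem hq _ _)
      (R.mul_mem (hR.gauss_mem hq _ _) h))

lemma IntegralWeight.mul_sq_pow {R : Subring K} (hR : Adapted R q) (hq : Generic q) {w : ℕ → K}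
    {j : ℕ} (h : IntegralWeight R q w j) (r : ℕ) :
    IntegralWeight R q
      (fun k => w k * (q ^ (-(2 * k) : ℤ) * qNum q (2 * k + 1) ^ 2) ^ r) j := by
  induction r with
  | zero => simpa using h
  | succ r ih => simpa only [pow_succ, mul_assoc] using ih.mul_sq hR hq

lemma gauss_eq_kernel (n k : ℕ) :
    gauss q (2 * n + 1) ((n : ℤ) - k) = qFact q (2 * n + 1) * kernel q n k := by
  rw [gauss, kernel, mul_assoc]
  congr 3
  push_cast
  ring

/-- Divisibility for the exponents `n ^ a, (n + 1) ^ b, (n + 2) ^ c` and an integral weight. -/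
theorem gauss_sum_mem {R : Subring K} (hR : Adapted R q) (hq : Generic q) {w : ℕ → K}
    (hw : ∀ j ≤ 1, IntegralWeight R q w j) {a b c n j : ℕ} (ha : 1 ≤ a) (hb : 1 ≤ b)
    (hc : 1 ≤ c) (hj : j ≤ a + b + c) :
    ∃ x ∈ R, ∑ k ∈ Finset.range (n + 1), w k * q ^ (j * (k ^ 2 + k))
        * gauss q (2 * n + 1) ((n : ℤ) - k) ^ a
        * gauss q (2 * (n + 1) + 1) (((n + 1 : ℕ) : ℤ) - k) ^ b
        * gauss q (2 * (n + 2) + 1) (((n + 2 : ℕ) : ℤ) - k) ^ c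
      = qNum q ((2 * n + 5 : ℕ) : ℤ) * gauss q (2 * n + 1) n * x := by
  obtain ⟨a, rfl⟩ := Nat.exists_eq_add_of_le' ha
  obtain ⟨b, rfl⟩ := Nat.exists_eq_add_of_le' hb
  obtain ⟨c, rfl⟩ := Nat.exists_eq_add_of_le' hc
  -- The jump `n → n+2` gives `[2n+3]!` and the step `n+2 → n+1` gives `[2n+4]!`; the latter
  -- replaces one `[2n+5]!` and frees the factor `[2n+5]`.
  have h := path_sum_mem hR hq hw (n + 1)
    (List.replicate a n ++ ((n + 2) :: (List.replicate c (n + 2) ++ List.replicate b (n + 1))))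
    (n + 1) n j (by omega) (by simp; omega)
  refine ⟨_, h, ?_⟩
  rw [pathFact_replicate_append, pathFact, pathFact_replicate_append, pathFact_replicate_end]
  simp only [gauss_eq_kernel, List.map_append, List.map_cons, List.prod_append, List.prod_cons,
    List.map_replicate, List.prod_replicate]
  simp only [mul_pow, Finset.mul_sum]
  refine Finset.sum_congr rfl fun k _ => ?_
  have h1 := hq.qFact_mul_invFact n
  have h2 := hq.qFact_mul_invFact (n + 1)
  have h5 : qFact q (2 * (n + 2) + 1)
      = qFact q (n + 2 + (n + 1) + 1) * qNum q ((2 * n + 5 : ℕ) : ℤ) := by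
    rw [show n + 2 + (n + 1) + 1 = 2 * (n + 2) by ring, qFact_succ]
    congr 2
  rw [gauss, show ((2 * n + 1 : ℕ) : ℤ) - n = ((n + 1 : ℕ) : ℤ) by push_cast; ring,
    show n + (n + 2) + 1 = 2 * (n + 1) + 1 by ring]
  set P := qFact q (2 * n + 1) ^ (a + 1) * qFact q (2 * (n + 1) + 1) ^ (b + 1)
      * qFact q (2 * (n + 2) + 1) ^ c * w k * q ^ (j * (k ^ 2 + k))
      * kernel q n k ^ (a + 1) * kernel q ((n + 1 : ℕ) : ℤ) k ^ (b + 1)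
      * kernel q ((n + 2 : ℕ) : ℤ) k ^ (c + 1) with hP
  calc _ = P * qFact q (2 * (n + 2) + 1) := by rw [hP]; ring
    _ = P * (qFact q (n + 2 + (n + 1) + 1) * qNum q ((2 * n + 5 : ℕ) : ℤ))
        * (qFact q n * invFact q n) * (qFact q (n + 1) * invFact q ((n + 1 : ℕ) : ℤ)) := by
      rw [h1, h2, h5]; ring
    _ = _ := by rw [hP]; ring

end Generic

/-! ### Specialization to rational functions -/

lemma generic_q : Generic q := by
  refine ⟨RatFunc.X_ne_zero, fun n hn h => ?_⟩
  have h' : algebraMap (Polynomial ℚ) (RatFunc ℚ) (Polynomial.X ^ n)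
      = algebraMap (Polynomial ℚ) (RatFunc ℚ) 1 := by
    simpa [q] using h
  have := congrArg Polynomial.natDegree (RatFunc.algebraMap_injective ℚ h')
  simp at this
  omega

lemma adapted_q : Adapted ofLaurent.range q := by
  refine ⟨⟨LaurentPolynomial.T 1, ?_⟩, ⟨LaurentPolynomial.T (-1), ?_⟩⟩ <;>
  simp [ofLaurent, show (qUnit : RatFunc ℚ) = q from rfl]

lemma qInt_eq_qNum (n : ℕ) : qInt n = qNum q n := by
  have h := mul_neg_geom_sum q n
  rw [qNum, zpow_natCast, eq_div_iff generic_q.one_sub_ne_zero, ← h, mul_comm, qInt]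

lemma qBinom_eq_gauss (n k : ℕ) (hk : k ≤ n) : qBinom n k = gauss q n k := by
  have hq := generic_q
  rw [qBinom, if_pos (Int.natCast_nonneg k), Int.toNat_natCast]
  induction k with
  | zero => simp [hq.gauss_zero_right]
  | succ k ih =>
    rw [Finset.prod_Icc_succ_top (by omega), ih (by omega), gauss, gauss]
    have h1 := hq.qNum_mul_invFact (((k + 1 : ℕ) : ℤ))
    have h2 := hq.qNum_mul_invFact ((n : ℤ) - k)
    rw [show ((k + 1 : ℕ) : ℤ) - 1 = k by push_cast; ring] at h1
    rw [show (n : ℤ) - k - 1 = n - (k + 1 : ℕ) by push_cast; ring] at h2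
    rw [← h1, ← h2, show (n : ℤ) - (k + 1 : ℕ) + 1 = n - k by push_cast; ring]
    have h3 : 1 - q ^ ((k + 1 : ℕ) : ℤ) ≠ 0 := by
      rw [zpow_natCast]
      exact sub_ne_zero.2 (hq.pow_ne_one _ k.succ_pos).symm
    have h4 := hq.one_sub_ne_zero
    unfold qNum
    field_simp

lemma epsPos_mul_pow (j r k : ℕ) :
    epsPos j r k * qInt (2 * k + 1) ^ (2 * r + 1)
      = q ^ (-(k : ℤ)) * qNum q (2 * k + 1)
        * (q ^ (-(2 * k) : ℤ) * qNum q (2 * k + 1) ^ 2) ^ r * q ^ (j * (k ^ 2 + k)) := by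
  have h0 := generic_q.ne_zero
  have : epsPos j r k
      = q ^ (-(k : ℤ)) * (q ^ (-(2 * k) : ℤ)) ^ r * q ^ (j * (k ^ 2 + k)) := by
    rw [epsPos, ← zpow_natCast, ← zpow_natCast, ← zpow_mul, ← zpow_add₀ h0, ← zpow_add₀ h0]
    congr 1
    push_cast
    ring
  rw [this, qInt_eq_qNum]
  push_cast
  ring

lemma epsAlt_mul_pow (j r k : ℕ) :
    epsAlt j r k * qInt (2 * k + 1) ^ (2 * r + 1)
      = (-1) ^ k * q ^ (k.choose 2) * qNum q (2 * k + 1)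
        * (q ^ (-(2 * k) : ℤ) * qNum q (2 * k + 1) ^ 2) ^ r * q ^ (j * (k ^ 2 + k)) := by
  have h0 := generic_q.ne_zero
  have : epsAlt j r k = (-1) ^ k
      * (q ^ (k.choose 2) * (q ^ (-(2 * k) : ℤ)) ^ r * q ^ (j * (k ^ 2 + k))) := by
    rw [epsAlt]
    congr 1
    rw [← zpow_natCast q (k.choose 2), ← zpow_natCast q (j * _), ← zpow_natCast, ← zpow_mul,
      ← zpow_add₀ h0, ← zpow_add₀ h0]
    congr 1
    push_cast
    ring
  rw [this, qInt_eq_qNum]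
  push_cast
  ring

end QSum

theorem corollary7p4 (a b c n j r : ℕ) (ha : 1 ≤ a) (hb : 1 ≤ b) (hc : 1 ≤ c) (hn : 1 ≤ n)
    (hj : j ≤ a + b + c) (ε : ℕ → RatFunc ℚ)
    (hε : ε = QSum.epsPos j r ∨ ε = QSum.epsAlt j r) :
    QSum.CongrMod
      (∑ k ∈ Finset.range (n + 1), ε k * QSum.qInt (2 * k + 1) ^ (2 * r + 1)
        * QSum.qBinom (2 * (n : ℤ) + 1) ((n : ℤ) - k) ^ a
        * QSum.qBinom (2 * (n : ℤ) + 3) ((n : ℤ) - k + 1) ^ b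
        * QSum.qBinom (2 * (n : ℤ) + 5) ((n : ℤ) - k + 2) ^ c)
      0
      (QSum.qInt (2 * n + 5) * QSum.qBinom (2 * (n : ℤ) + 1) (n : ℤ)) := by
  have hq := QSum.generic_q
  have hR := QSum.adapted_q
  obtain ⟨w, hw, hεw⟩ : ∃ w : ℕ → RatFunc ℚ,
      (∀ i ≤ 1, QSum.IntegralWeight QSum.ofLaurent.range QSum.q w i) ∧
      ∀ k, ε k * QSum.qInt (2 * k + 1) ^ (2 * r + 1) = w k * QSum.q ^ (j * (k ^ 2 + k)) := by
    rcases hε with rfl | rfl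
    · exact ⟨_, fun i hi => (QSum.integralWeight_pos hR hq hi).mul_sq_pow hR hq r,
        QSum.epsPos_mul_pow j r⟩
    · exact ⟨_, fun i hi => (QSum.integralWeight_alt hR hq hi).mul_sq_pow hR hq r,
        QSum.epsAlt_mul_pow j r⟩
  obtain ⟨x, ⟨L, rfl⟩, h⟩ := QSum.gauss_sum_mem (n := n) hR hq hw ha hb hc hj
  have hbin : ∀ m i : ℕ, m ≤ 2 → i ≤ n + m → QSum.qBinom (2 * (n : ℤ) + (2 * m + 1)) (n - i + m)
      = QSum.gauss QSum.q (2 * (n + m) + 1) (((n + m : ℕ) : ℤ) - i) := by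
    intro m i _ hi
    have := QSum.qBinom_eq_gauss (2 * (n + m) + 1) (n + m - i) (by omega)
    rw [Nat.cast_sub hi] at this
    rw [← this]
    congr 1 <;> push_cast <;> ring
  refine ⟨L, ?_⟩
  rw [sub_zero, QSum.qInt_eq_qNum,
    show 2 * (n : ℤ) + 1 = ((2 * n + 1 : ℕ) : ℤ) by push_cast; ring,
    QSum.qBinom_eq_gauss _ _ (by omega), ← h]
  refine Finset.sum_congr rfl fun k hk => ?_
  have hk := Finset.mem_range.1 hk
  have b0 := hbin 0 k (by omega) (by omega)
  have b1 := hbin 1 k (by omega) (by omega)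
  have b2 := hbin 2 k (by omega) (by omega)
  norm_num at b0 b1 b2
  push_cast
  rw [hεw, b0, b1, b2]
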